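/- Let $\mathrm{QFT}_n$ be the $n$-qubit quantum Fourier transform without bit reversal, i.e. the linear map on $(\mathbb{C}^2)^{\otimes n}$ with $$\mathrm{QFT}_n|x_1\cdots x_n\rangle=\frac{1}{2^{n/2}}\bigotimes_{j=1}^{n}\bigl(|0\rangle+e^{2\pi i\,0.x_jx_{j+1}\cdots x_n}|1\rangle\bigr),\qquad 0.x_jx_{j+1}\cdots x_n=\sum_{k=j}^n x_k2^{-(k-j+1)} .$$ Consider two processors, each holding $m$ ancilla qubits in addition to the data qubits assigned to it by a partition $\pi:[n]\to\{1,2\}$. A circuit is a finite sequence of operations, each of which is either an arbitrary unitary on the qubits of one processor (free) or an arbitrary two-qubit unitary on two qubits held by different processors (a nonlocal gate, of cost $1$). It implements an $n$-qubit unitary $U$ if it maps $|\psi\rangle\otimes|0\cdots0\rangle$ to $U|\psi\rangle\otimes|0\cdots0\rangle$ for every state $\psi$ of the data qubits, where the second factor is the state of all $2m$ ancillas. Fix a constant $c\ge 1/2$ and call $\pi$ balanced if $\bigl||\pi^{-1}(\ell)|-n/2\bigr|\le c$ for $\ell=1,2$. Let $\mathcal{C}_m(U)$ be the least number of nonlocal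 gates in a circuit that implements $U$, minimized over all balanced partitions $\pi$ and all circuits, and let $\mathcal{C}_\infty(U)=\inf_{m\ge0}\mathcal{C}_m(U)$. **Theorem.** For every integer $m\ge1$, $\mathcal{C}_m(\mathrm{QFT}_n)=\Theta(n)$ as $n\to\infty$. More precisely: 1. $\mathcal{C}_1(\mathrm{QFT}_n)\le n$ for every $n\ge0$, that is, one ancilla per processor and at most $n$ nonlocal two-qubit gates suffice; 2. $\mathcal{C}_\infty(\mathrm{QFT}_n)=\Omega(n)$, that is, there are $a>0$ and $N$, depending only on $c$, such that $\mathcal{C}_m(\mathrm{QFT}_n)\ge a\,n$ for all $n\ge N$ and all $m\ge0$. -/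

import Mathlib

open scoped ENNReal

noncomputable section

namespace QComm

/-- The two processors, `0` (called `A`) and `1` (called `B`). -/
abbrev Proc : Type := Fin 2

/-- Classical bit strings indexed by a set `Q` of qubits: the computational basis of the
Hilbert space of the register `Q`. -/
abbrev Bits (Q : Type*) : Type _ := Q → Fin 2

/-- All the qubits of the device: `n` data (input) qubits, and `m` ancilla qubits on each of the
two processors. -/
abbrev Qubit (n m : ℕ) : Type := Fin n ⊕ (Proc × Fin m)

/-- The processor that holds a qubit, when the data qubits are distributed by `π`. -/
def owner {n m : ℕ} (π : Fin n → Proc) : Qubit n m → Proc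
  | Sum.inl i => π i
  | Sum.inr (p, _) => p

/-- The qubits held by the processor `p`. -/
def held {n : ℕ} (m : ℕ) (π : Fin n → Proc) (p : Proc) : Finset (Qubit n m) :=
  Finset.univ.filter fun q => owner π q = p

/-- `V ⊗ I`: the operator on the register `Q` that acts as `V` on the qubits in `S` and as the
identity on all other qubits. -/
def onQubits {Q : Type*} [Fintype Q] [DecidableEq Q] (S : Finset Q)
    (V : Matrix (Bits S) (Bits S) ℂ) : Matrix (Bits Q) (Bits Q) ℂ :=
  fun y x => if ∀ q, q ∉ S → y q = x q then V (fun q => y q) (fun q => x q) else 0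

/-- One operation of a two-processor circuit: an arbitrary unitary on the qubits of one
processor, or an arbitrary two-qubit unitary on two qubits held by different processors. -/
inductive Gate {n : ℕ} (m : ℕ) (π : Fin n → Proc) : Type
  | localOp (p : Proc) (V : Matrix.unitaryGroup (Bits (held m π p)) ℂ) : Gate m π
  | nonlocal (a b : Qubit n m) (hab : owner π a ≠ owner π b)
      (V : Matrix.unitaryGroup (Bits ({a, b} : Finset (Qubit n m))) ℂ) : Gate m π

/-- The operator on the whole device that a gate performs. -/
def Gate.op {n m : ℕ} {π : Fin n → Proc} : Gate m π → Matrix (Bits (Qubit n m)) (Bits (Qubit n m)) ℂ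
  | .localOp p V => onQubits (held m π p) V.1
  | .nonlocal a b _ V => onQubits {a, b} V.1

/-- The communication cost of a gate: nonlocal gates cost one, local operations are free. -/
def Gate.cost {n m : ℕ} {π : Fin n → Proc} : Gate m π → ℕ
  | .localOp _ _ => 0
  | .nonlocal _ _ _ _ => 1

/-- A circuit is a finite sequence of gates; the last gate of the list is applied first. -/
abbrev Circuit {n : ℕ} (m : ℕ) (π : Fin n → Proc) : Type := List (Gate m π)

/-- The operator that a circuit performs. -/
def Circuit.op {n m : ℕ} {π : Fin n → Proc} (T : Circuit m π) :
    Matrix (Bits (Qubit n m)) (Bits (Qubit n m)) ℂ :=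
  (T.map Gate.op).prod

/-- The number of nonlocal two-qubit gates of a circuit. -/
def Circuit.cost {n m : ℕ} {π : Fin n → Proc} (T : Circuit m π) : ℕ :=
  (T.map Gate.cost).sum

/-- The state `|ψ⟩ ⊗ |0⋯0⟩`, with `ψ` on the data qubits and all ancillas in `|0⟩`. -/
def withAncillas {n : ℕ} (m : ℕ) (ψ : Bits (Fin n) → ℂ) : Bits (Qubit n m) → ℂ :=
  fun z => if ∀ a, z (Sum.inr a) = 0 then ψ (fun i => z (Sum.inl i)) else 0

/-- The circuit exactly implements `U` with clean ancillas:
`|ψ⟩ ⊗ |0⋯0⟩` is mapped to `U|ψ⟩ ⊗ |0⋯0⟩` for every state `ψ` of the data qubits. -/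
def Circuit.Implements {n m : ℕ} {π : Fin n → Proc} (T : Circuit m π)
    (U : Matrix (Bits (Fin n)) (Bits (Fin n)) ℂ) : Prop :=
  ∀ ψ : Bits (Fin n) → ℂ,
    Matrix.mulVec T.op (withAncillas m ψ) = withAncillas m (Matrix.mulVec U ψ)

/-- `𝒞_m(U ∣ π)`: the least number of nonlocal two-qubit gates in a circuit that implements `U`
when the data qubits are distributed by `π` (`⊤` if there is no such circuit). -/
def commGiven {n : ℕ} (m : ℕ) (U : Matrix (Bits (Fin n)) (Bits (Fin n)) ℂ)
    (π : Fin n → Proc) : ℕ∞ :=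
  ⨅ (T : Circuit m π) (_ : T.Implements U), (T.cost : ℕ∞)

/-- A partition is balanced, with slack `c`, if each processor holds `n / 2` data qubits up to an
additive error of at most `c`. -/
def Balanced {n : ℕ} (c : ℝ) (π : Fin n → Proc) : Prop :=
  ∀ p : Proc, |((Finset.univ.filter fun i => π i = p).card : ℝ) - (n : ℝ) / 2| ≤ c

/-- `𝒞_m(U)`: the communication complexity of `U` with `m` ancillas per processor, optimized over
all balanced partitions (with slack `c`). -/
def commCost {n : ℕ} (c : ℝ) (m : ℕ) (U : Matrix (Bits (Fin n)) (Bits (Fin n)) ℂ) : ℕ∞ :=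
  ⨅ (π : Fin n → Proc) (_ : Balanced c π), commGiven m U π

/-- `𝒞_∞(U)`: the communication complexity with unboundedly many ancillas. -/
def commInf {n : ℕ} (c : ℝ) (U : Matrix (Bits (Fin n)) (Bits (Fin n)) ℂ) : ℕ∞ :=
  ⨅ m : ℕ, commCost c m U

/-- The binary fraction `0.x_j x_{j+1} ⋯ x_n`. -/
def binFrac {n : ℕ} (x : Bits (Fin n)) (j : Fin n) : ℝ :=
  ∑ k ∈ Finset.Ici j, ((x k : ℕ) : ℝ) / 2 ^ ((k : ℕ) - (j : ℕ) + 1)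

/-- The `n`-qubit quantum Fourier transform without bit reversal,
`|x_1 ⋯ x_n⟩ ↦ 2^{-n/2} ⨂_j (|0⟩ + e^{2πi 0.x_j ⋯ x_n} |1⟩)`; the entry at `(y, x)` is the
amplitude of `|y⟩` in the image of `|x⟩`. -/
def QFT (n : ℕ) : Matrix (Bits (Fin n)) (Bits (Fin n)) ℂ :=
  fun y x => ((Real.sqrt 2 : ℂ) ^ n)⁻¹ *
    ∏ j, if y j = 1 then Complex.exp (2 * Real.pi * Complex.I * (binFrac x j : ℂ)) else 1

end QComm

end

/-!
Write `ζ` for the root of unity `rootTwoPow n` of order `2 ^ n`. Up to a scalar, the entry of the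
Fourier matrix at `(y, x)` is `ζ ^ (Y * X)`, where `Y` is `y` read with the least and `X` is `x`
read with the most significant digit first (`QFT_apply`).

*Lower bound.* A gate across the cut is a sum of four product operators, so a circuit of cost `k`
has operator Schmidt rank at most `4 ^ k` (`Circuit.schmidtLE`). Hence the block of the Fourier
matrix with rows `y` supported on the processor `l` and columns `x` supported on the other one has
rank at most `4 ^ k`. Let `p` be the smaller of the numbers of qubits of the two processors. If the
rows were all `Y < 2 ^ p`, the block would be a Vandermonde matrix with at least `2 ^ p` distinct
nodes `ζ ^ X`, of rank `2 ^ p`. Only the digits below `p` held by `l` are available; each missing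
digit at most doubles the rank when it is inserted, because setting it multiplies the columns by
scalars. So `2 ^ p ≤ 4 ^ k * 2 ^ u`, where `u` counts the digits below `p` that `l` does not hold
(`two_pow_le_of_block_factor`). For the two choices of `l` the numbers `u` add up to `p`, and the
product of the two inequalities gives `p ≤ 4 * k` (`le_four_mul_cost`), for every partition and any
number of ancillas.

*Upper bound.* Give the first half of the qubits to one processor. The Fourier transform is a
product of rounds, one for each qubit `t`: a Hadamard gate on `t` and phase shifts of `t` controlled
by later qubits (`partialQFT_succ`). The shifts controlled from the other processor are performed
there, on a copy of `t` that one CNOT puts into an ancilla and another one removes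
(`exists_implements_crossRound`). Only the `n / 2` rounds of the first half need this, so the cost is
`2 * (n / 2) ≤ n`.
-/

namespace QComm

/-! ### The Fourier matrix as a table of powers of one root of unity -/

/-- The number whose binary digits are `y`, least significant digit first. -/
def lsbVal {n : ℕ} (y : Bits (Fin n)) : ℕ := ∑ j, (y j : ℕ) * 2 ^ (j : ℕ)

/-- The number whose binary digits are `x`, most significant digit first. -/
def msbVal {n : ℕ} (x : Bits (Fin n)) : ℕ := ∑ k, (x k : ℕ) * 2 ^ (n - 1 - (k : ℕ))

/-- The standard primitive root of unity of order `2 ^ n`. -/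
noncomputable def rootTwoPow (n : ℕ) : ℂ := Complex.exp (2 * Real.pi * Complex.I / ((2 ^ n : ℕ) : ℂ))

lemma isPrimitiveRoot_rootTwoPow (n : ℕ) : IsPrimitiveRoot (rootTwoPow n) (2 ^ n) :=
  Complex.isPrimitiveRoot_exp _ (by positivity)

/-- Digits `x k` with `k < j` contribute whole turns to `2 ^ j * msbVal x / 2 ^ n`, so only the
binary fraction `0.x_j x_{j+1} ⋯` is left in the phase. -/
lemma rootTwoPow_pow_msbVal {n : ℕ} (x : Bits (Fin n)) (j : Fin n) :
    rootTwoPow n ^ (2 ^ (j : ℕ) * msbVal x) =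
      Complex.exp (2 * Real.pi * Complex.I * (binFrac x j : ℂ)) := by
  have key : ((2 ^ (j : ℕ) * msbVal x : ℕ) : ℝ) / 2 ^ n =
      binFrac x j + ((∑ k ∈ Finset.Iio j, (x k : ℕ) * 2 ^ ((j : ℕ) - 1 - k) : ℕ) : ℝ) := by
    have hsplit : (Finset.univ : Finset (Fin n)) = Finset.Ici j ∪ Finset.Iio j := by
      ext k; simp [le_or_gt]
    have hdisj : Disjoint (Finset.Ici j) (Finset.Iio j) := by
      rw [Finset.disjoint_left]; intro k hk; simpa using hk
    unfold binFrac msbVal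
    rw [hsplit, Finset.sum_union hdisj, mul_add, Nat.cast_add, add_div]
    push_cast
    congr 1
    · rw [Finset.mul_sum, Finset.sum_div]
      refine Finset.sum_congr rfl fun k hk => ?_
      have hk' : (j : ℕ) ≤ k := by simpa using hk
      have e : (2 : ℝ) ^ n = 2 ^ (n - 1 - (k : ℕ)) * 2 ^ ((k : ℕ) - j + 1) * 2 ^ (j : ℕ) := by
        rw [← pow_add, ← pow_add]; congr 1; omega
      rw [e]
      field_simp
    · rw [Finset.mul_sum, Finset.sum_div]
      refine Finset.sum_congr rfl fun k hk => ?_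
      have hk' : (k : ℕ) < j := by simpa using hk
      have e : (2 : ℝ) ^ (j : ℕ) * 2 ^ (n - 1 - (k : ℕ)) = 2 ^ ((j : ℕ) - 1 - k) * 2 ^ n := by
        rw [← pow_add, ← pow_add]; congr 1; omega
      rw [div_eq_iff (by positivity)]
      linear_combination ((x k : ℕ) : ℝ) * e
  have key' := congrArg (fun r : ℝ => (r : ℂ)) key
  push_cast at key'
  rw [rootTwoPow, ← Complex.exp_nat_mul, Complex.exp_eq_exp_iff_exists_int]
  refine ⟨((∑ k ∈ Finset.Iio j, (x k : ℕ) * 2 ^ ((j : ℕ) - 1 - k) : ℕ) : ℤ), ?_⟩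
  push_cast
  linear_combination (2 * Real.pi * Complex.I) * key'

theorem QFT_apply {n : ℕ} (y x : Bits (Fin n)) :
    QFT n y x = ((Real.sqrt 2 : ℂ) ^ n)⁻¹ * rootTwoPow n ^ (lsbVal y * msbVal x) := by
  unfold QFT
  congr 1
  rw [lsbVal, Finset.sum_mul, ← Finset.prod_pow_eq_pow_sum]
  refine Finset.prod_congr rfl fun j _ => ?_
  rw [← rootTwoPow_pow_msbVal]
  rcases Fin.exists_fin_two.1 ⟨y j, rfl⟩ with h | h <;> simp [h]

lemma msbVal_eq {n : ℕ} (x : Bits (Fin n)) :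
    msbVal x = (finFunctionFinEquiv (x ∘ Fin.rev) : ℕ) := by
  rw [finFunctionFinEquiv_apply, msbVal, ← Equiv.sum_comp Fin.revPerm]
  refine Finset.sum_congr rfl fun k _ => ?_
  simp only [Fin.revPerm_apply, Function.comp, Fin.val_rev]
  congr 2
  omega

lemma msbVal_lt {n : ℕ} (x : Bits (Fin n)) : msbVal x < 2 ^ n := by
  rw [msbVal_eq]; exact Fin.is_lt _

lemma msbVal_injective (n : ℕ) : Function.Injective (msbVal (n := n)) := by
  intro x x' h
  rw [msbVal_eq, msbVal_eq] at h
  have := finFunctionFinEquiv.injective (Fin.ext h)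
  funext k
  simpa using congrFun this (Fin.rev k)

lemma rootTwoPow_pow_msbVal_injective (n : ℕ) :
    Function.Injective fun x : Bits (Fin n) => rootTwoPow n ^ msbVal x := fun x x' h =>
  msbVal_injective n ((isPrimitiveRoot_rootTwoPow n).pow_inj (msbVal_lt x) (msbVal_lt x') h)

/-! ### A rank bound from Vandermonde matrices -/

/-- A Vandermonde matrix with distinct nodes has full rank, so it is no sum of fewer rank-one
matrices than it has rows. -/
lemma le_card_of_vandermonde_factor {N : ℕ} {κ : Type*} [Fintype κ] {v : Fin N → ℂ}
    (hv : Function.Injective v) (f g : κ → Fin N → ℂ)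
    (h : ∀ Y x : Fin N, v x ^ (Y : ℕ) = ∑ i, f i Y * g i x) : N ≤ Fintype.card κ := by
  classical
  have e : Matrix.vandermonde v =
      (Matrix.of fun x i => g i x : Matrix (Fin N) κ ℂ) * (Matrix.of fun i Y => f i Y) := by
    ext x Y
    simp [Matrix.mul_apply, Matrix.vandermonde_apply, h, mul_comm]
  have hu : IsUnit (Matrix.vandermonde v) := by
    rw [Matrix.isUnit_iff_isUnit_det, isUnit_iff_ne_zero]
    exact Matrix.det_vandermonde_ne_zero_iff.2 hv
  have hr := Matrix.rank_of_isUnit _ hu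
  rw [e, Fintype.card_fin] at hr
  rw [← hr]
  exact (Matrix.rank_mul_le_left _ _).trans (Matrix.rank_le_card_width _)

/-- If the block of the Fourier matrix with rows supported on the processor `l` and columns
supported on the other one has rank at most `card ι`, then inserting the row digits below `p` that
`l` does not hold multiplies the rank by at most two each, and completes the rows to the numbers
below `2 ^ p`. For these the block is a Vandermonde matrix. -/
theorem two_pow_le_of_block_factor {n p : ℕ} (π : Fin n → Proc) (l : Proc) {ι : Type*} [Fintype ι]
    (f g : ι → Bits (Fin n) → ℂ)
    (h : ∀ y x, (∀ k, π k ≠ l → y k = 0) → (∀ k, π k = l → x k = 0) →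
      QFT n y x = ∑ i, f i y * g i x)
    (hp : p ≤ (Finset.univ.filter fun k => π k ≠ l).card) :
    2 ^ p ≤ Fintype.card ι *
      2 ^ (Finset.univ.filter fun k : Fin n => (k : ℕ) < p ∧ π k ≠ l).card := by
  classical
  have hpn : p ≤ n := hp.trans ((Finset.card_filter_le _ _).trans (by simp))
  -- distinct column digits supported off `l`
  obtain ⟨emb⟩ : Nonempty (Fin (2 ^ p) ↪ ({k // π k ≠ l} → Fin 2)) := by
    apply Function.Embedding.nonempty_of_card_le
    rw [Fintype.card_fin, Fintype.card_fun, Fintype.card_fin, Fintype.card_subtype]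
    exact Nat.pow_le_pow_right (by norm_num) hp
  let col : Fin (2 ^ p) → Bits (Fin n) := fun Z k => if hk : π k ≠ l then emb Z ⟨k, hk⟩ else 0
  have hcol0 : ∀ Z k, π k = l → col Z k = 0 := fun Z k hk => by simp [col, hk]
  have hcol : Function.Injective col := by
    intro Z Z' hZ
    apply emb.injective
    funext k
    have := congrFun hZ k.1
    simpa [col, k.2] using this
  let row : Fin (2 ^ p) → Bits (Fin n) := fun Y =>
    finFunctionFinEquiv.symm ⟨Y, Y.2.trans_le (Nat.pow_le_pow_right (by norm_num) hpn)⟩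
  have hrow : ∀ Y, lsbVal (row Y) = Y := fun Y => by
    rw [lsbVal, ← finFunctionFinEquiv_apply]; simp [row]
  have hrow0 : ∀ Y (k : Fin n), p ≤ k → row Y k = 0 := fun Y k hk => by
    have : (Y : ℕ) / 2 ^ (k : ℕ) = 0 :=
      Nat.div_eq_of_lt (Y.2.trans_le (Nat.pow_le_pow_right (by norm_num) hk))
    ext
    simp [row, finFunctionFinEquiv, this]
  -- the digits of a row held by `l`, and the other digits
  let own : Fin (2 ^ p) → Bits (Fin n) := fun Y k => if π k = l then row Y k else 0
  let G := {k : Fin n // (k : ℕ) < p ∧ π k ≠ l}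
  let rest : Fin (2 ^ p) → (G → Fin 2) := fun Y k => row Y k
  let ext : (G → Fin 2) → Bits (Fin n) := fun γ k =>
    if hk : (k : ℕ) < p ∧ π k ≠ l then γ ⟨k, hk⟩ else 0
  have hadd : ∀ Y, lsbVal (own Y) + lsbVal (ext (rest Y)) = Y := fun Y => by
    rw [← hrow Y]
    unfold lsbVal
    rw [← Finset.sum_add_distrib]
    refine Finset.sum_congr rfl fun k _ => ?_
    rw [← add_mul]
    congr 1
    by_cases hk : π k = l
    · simp [own, ext, hk]
    · by_cases hk' : (k : ℕ) < p
      · simp [own, ext, rest, hk, hk']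
      · simp [own, ext, hk, hk', hrow0 Y k (not_lt.1 hk')]
  set s : ℂ := ((Real.sqrt 2 : ℂ) ^ n) with hs
  have hs0 : s ≠ 0 := by
    rw [hs]
    exact pow_ne_zero _ (by simp)
  have := le_card_of_vandermonde_factor (κ := ι × (G → Fin 2))
    (v := fun Z => rootTwoPow n ^ msbVal (col Z))
    ((rootTwoPow_pow_msbVal_injective n).comp hcol)
    (fun i Y => if rest Y = i.2 then f i.1 (own Y) else 0)
    (fun i Z => s * (g i.1 (col Z) * rootTwoPow n ^ (lsbVal (ext i.2) * msbVal (col Z))))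
    (fun Y Z => by
      have h1 := h (own Y) (col Z) (fun k hk => by simp [own, hk]) (hcol0 Z)
      rw [QFT_apply, ← hs, inv_mul_eq_iff_eq_mul₀ hs0] at h1
      rw [Fintype.sum_prod_type]
      rw [← pow_mul, mul_comm (msbVal _)]
      conv_lhs => rw [← hadd Y, add_mul, pow_add, h1, Finset.mul_sum, Finset.sum_mul]
      refine Finset.sum_congr rfl fun i _ => ?_
      rw [Finset.sum_eq_single (rest Y) (fun γ _ hγ => by rw [if_neg hγ.symm, zero_mul]) (by simp),
        if_pos rfl]
      ring)
  simpa [G, Fintype.card_subtype] using this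

/-! ### Operator Schmidt rank -/

/-- The registers of the two processors: a bit string on `Q` is a pair of bit strings, one on the
qubits in `S` and one on the others. -/
def splitBits {Q : Type*} [DecidableEq Q] (S : Finset Q) :
    Bits Q ≃ Bits {q // q ∈ S} × Bits {q // q ∉ S} :=
  Equiv.piEquivPiSubtypeProd (fun q => q ∈ S) fun _ => Fin 2

/-- The operator Schmidt rank of `M` across the cut between `S` and its complement is at most
`r`. -/
def SchmidtLE {Q : Type*} [Fintype Q] [DecidableEq Q] (S : Finset Q) (r : ℕ)
    (M : Matrix (Bits Q) (Bits Q) ℂ) : Prop :=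
  ∃ (ι : Type) (_ : Fintype ι), Fintype.card ι ≤ r ∧
    ∃ (P : ι → Matrix (Bits {q // q ∈ S}) (Bits {q // q ∈ S}) ℂ)
      (R : ι → Matrix (Bits {q // q ∉ S}) (Bits {q // q ∉ S}) ℂ),
      M = (∑ i, Matrix.kronecker (P i) (R i)).submatrix (splitBits S) (splitBits S)

section Schmidt

variable {Q : Type*} [Fintype Q] [DecidableEq Q] {S : Finset Q}

lemma SchmidtLE.of_sum {ι : Type} [Fintype ι] {M : Matrix (Bits Q) (Bits Q) ℂ}
    (P : ι → Bits {q // q ∈ S} → Bits {q // q ∈ S} → ℂ)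
    (R : ι → Bits {q // q ∉ S} → Bits {q // q ∉ S} → ℂ)
    (h : ∀ y x, M y x = ∑ i, P i (fun q => y q) (fun q => x q) * R i (fun q => y q) (fun q => x q)) :
    SchmidtLE S (Fintype.card ι) M := by
  refine ⟨ι, inferInstance, le_rfl, fun i => Matrix.of (P i), fun i => Matrix.of (R i), ?_⟩
  ext y x
  rw [Matrix.submatrix_apply, Matrix.sum_apply, h]
  rfl

lemma SchmidtLE.one : SchmidtLE S 1 (1 : Matrix (Bits Q) (Bits Q) ℂ) :=
  ⟨Unit, inferInstance, by simp, fun _ => 1, fun _ => 1, by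
    simp [Matrix.submatrix_one_equiv]⟩

lemma SchmidtLE.mul {r r' : ℕ} {M M' : Matrix (Bits Q) (Bits Q) ℂ} (h : SchmidtLE S r M)
    (h' : SchmidtLE S r' M') : SchmidtLE S (r * r') (M * M') := by
  obtain ⟨ι, _, hr, P, R, rfl⟩ := h
  obtain ⟨ι', _, hr', P', R', rfl⟩ := h'
  refine ⟨ι × ι', inferInstance, ?_, fun i => P i.1 * P' i.2, fun i => R i.1 * R' i.2, ?_⟩
  · rw [Fintype.card_prod]; exact Nat.mul_le_mul hr hr'
  · rw [Matrix.submatrix_mul_equiv, Finset.sum_mul_sum, Fintype.sum_prod_type]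
    congr 1
    exact Finset.sum_congr rfl fun i _ => Finset.sum_congr rfl fun j _ =>
      (Matrix.mul_kronecker_mul _ _ _ _).symm

lemma SchmidtLE.onQubits_self (V : Matrix (Bits S) (Bits S) ℂ) : SchmidtLE S 1 (onQubits S V) :=
  SchmidtLE.of_sum (ι := Unit) (fun _ => V) (fun _ y x => if y = x then 1 else 0) fun y x => by
    simp [onQubits, funext_iff]

lemma SchmidtLE.onQubits_disjoint {S' : Finset Q} (hS : ∀ q, q ∈ S' ↔ q ∉ S)
    (V : Matrix (Bits S') (Bits S') ℂ) : SchmidtLE S 1 (onQubits S' V) :=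
  SchmidtLE.of_sum (ι := Unit) (fun _ y x => if y = x then 1 else 0) (fun _ y x =>
    V (fun q => y ⟨q, (hS q).1 q.2⟩) (fun q => x ⟨q, (hS q).1 q.2⟩)) fun y x => by
    simp [onQubits, funext_iff, hS]

/-- A two-qubit gate across the cut is a sum, over the four matrix units on its qubit in `S`, of
product operators. -/
lemma SchmidtLE.onQubits_pair {S' : Finset Q} {a b : Q} (ha : a ∈ S) (hb : b ∉ S)
    (hS : ∀ q, q ∈ S' ↔ q = a ∨ q = b) (V : Matrix (Bits S') (Bits S') ℂ) :
    SchmidtLE S 4 (onQubits S' V) := by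
  refine SchmidtLE.of_sum (ι := Fin 2 × Fin 2)
    (fun i y x => if y ⟨a, ha⟩ = i.1 ∧ x ⟨a, ha⟩ = i.2 ∧ ∀ q, q.1 ≠ a → y q = x q then 1 else 0)
    (fun i y x => if ∀ q, q.1 ≠ b → y q = x q then
      V (fun q => if q.1 = a then i.1 else y ⟨b, hb⟩)
        (fun q => if q.1 = a then i.2 else x ⟨b, hb⟩) else 0) fun y x => ?_
  rw [Finset.sum_eq_single ((y a, x a) : Fin 2 × Fin 2)]
  · have key : (∀ q, q ∉ S' → y q = x q) ↔
        (∀ q : {q // q ∈ S}, q.1 ≠ a → y q = x q) ∧ ∀ q : {q // q ∉ S}, q.1 ≠ b → y q = x q := by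
      constructor
      · intro h
        refine ⟨fun q hq => h q fun h' => ?_, fun q hq => h q fun h' => ?_⟩
        · rcases (hS q).1 h' with h' | h'
          · exact hq h'
          · exact hb (h' ▸ q.2)
        · rcases (hS q).1 h' with h' | h'
          · exact q.2 (h' ▸ ha)
          · exact hq h'
      · rintro ⟨h1, h2⟩ q hq
        rw [hS, not_or] at hq
        by_cases hqS : q ∈ S
        · exact h1 ⟨q, hqS⟩ hq.1
        · exact h2 ⟨q, hqS⟩ hq.2
    have hres : ∀ z : Bits Q, (fun q : S' => z q) = fun q : S' => if q.1 = a then z a else z b := by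
      intro z
      funext q
      rcases (hS q).1 q.2 with h | h
      · simp [h]
      · by_cases h' : q.1 = a
        · simp [h']
        · rw [if_neg h', h]
    rw [onQubits, hres y, hres x]
    simp only [key, ite_and, ite_mul, one_mul, zero_mul, if_true]
  · intro i _ hi
    rw [if_neg, zero_mul]
    rintro ⟨h1, h2, -⟩
    exact hi (Prod.ext h1.symm h2.symm)
  · simp

end Schmidt

lemma proc_cases : ∀ p : Proc, p = 0 ∨ p = 1 := by decide

lemma mem_held {n m : ℕ} {π : Fin n → Proc} {p : Proc} {q : Qubit n m} :
    q ∈ held m π p ↔ owner π q = p := by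
  simp [held]

lemma Gate.schmidtLE {n m : ℕ} {π : Fin n → Proc} (G : Gate m π) :
    SchmidtLE (held m π 0) (4 ^ G.cost) G.op := by
  rcases G with ⟨p, V⟩ | ⟨a, b, hab, V⟩
  · obtain rfl | rfl := proc_cases p
    · exact SchmidtLE.onQubits_self V.1
    · refine SchmidtLE.onQubits_disjoint (fun q => ?_) V.1
      rw [mem_held, mem_held]
      generalize owner π q = p
      revert p; decide
  · by_cases ha : owner π a = 0
    · exact SchmidtLE.onQubits_pair (a := a) (b := b) (mem_held.2 ha)
        (fun hb => hab (ha.trans (mem_held.1 hb).symm)) (by simp) V.1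
    · refine SchmidtLE.onQubits_pair (a := b) (b := a) (mem_held.2 ?_)
        (fun hb => ha (mem_held.1 hb)) (by simp [or_comm]) V.1
      revert hab ha
      generalize owner π a = p
      generalize owner π b = p'
      revert p p'; decide

lemma Circuit.schmidtLE {n m : ℕ} {π : Fin n → Proc} (T : Circuit m π) :
    SchmidtLE (held m π 0) (4 ^ Circuit.cost T) (Circuit.op T) := by
  induction T with
  | nil => simpa [Circuit.cost, Circuit.op] using SchmidtLE.one
  | cons G T ih =>
    have := G.schmidtLE.mul ih
    rwa [← pow_add] at this

lemma Circuit.Implements.apply {n m : ℕ} {π : Fin n → Proc} {T : Circuit m π}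
    {U : Matrix (Bits (Fin n)) (Bits (Fin n)) ℂ} (h : T.Implements U) (y x : Bits (Fin n)) :
    U y x = Circuit.op T (Sum.elim y 0) (Sum.elim x 0) := by
  have h1 := congrFun (h (Pi.single x 1)) (Sum.elim y 0)
  have h2 : withAncillas m (Pi.single x (1 : ℂ)) = Pi.single (Sum.elim x 0 : Bits (Qubit n m)) 1 := by
    funext z
    by_cases hz : z = Sum.elim x 0
    · subst hz; simp [withAncillas]
    · rw [Pi.single_eq_of_ne hz, withAncillas]
      split_ifs with h0
      · rw [Pi.single_eq_of_ne]
        rintro rfl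
        apply hz
        funext q
        rcases q with q | q
        · rfl
        · exact h0 q
      · rfl
  rw [h2, Matrix.mulVec_single_one, withAncillas] at h1
  simpa using h1.symm

/-- The block of `U` with rows supported on one processor and columns supported on the other has rank
at most `4 ^ cost`: fixing the remaining arguments of a sum of product operators leaves a sum of
rank-one matrices. -/
lemma Circuit.Implements.exists_block_factor {n m : ℕ} {π : Fin n → Proc} {T : Circuit m π}
    {U : Matrix (Bits (Fin n)) (Bits (Fin n)) ℂ} (h : T.Implements U) (l : Proc) :
    ∃ (ι : Type) (_ : Fintype ι), Fintype.card ι ≤ 4 ^ Circuit.cost T ∧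
      ∃ f g : ι → Bits (Fin n) → ℂ, ∀ y x, (∀ k, π k ≠ l → y k = 0) →
        (∀ k, π k = l → x k = 0) → U y x = ∑ i, f i y * g i x := by
  obtain ⟨ι, _, hr, P, R, hPR⟩ := Circuit.schmidtLE T
  let S := held m π 0
  let ext : Bits (Fin n) → Bits (Qubit n m) := fun z => Sum.elim z 0
  have hin : ∀ z : Bits (Fin n), (∀ k, π k = 0 → z k = 0) → (splitBits S (ext z)).1 = 0 := by
    intro z hz
    funext q
    obtain ⟨q | q, hq⟩ := q
    · exact hz q (mem_held.1 hq)
    · rfl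
  have hout : ∀ z : Bits (Fin n), (∀ k, π k ≠ 0 → z k = 0) → (splitBits S (ext z)).2 = 0 := by
    intro z hz
    funext q
    obtain ⟨q | q, hq⟩ := q
    · exact hz q fun h => hq (mem_held.2 h)
    · rfl
  have hU : ∀ y x, U y x = ∑ i, P i (splitBits S (ext y)).1 (splitBits S (ext x)).1 *
      R i (splitBits S (ext y)).2 (splitBits S (ext x)).2 := by
    intro y x
    rw [h.apply, hPR, Matrix.submatrix_apply, Matrix.sum_apply]
    rfl
  refine ⟨ι, inferInstance, hr, ?_⟩
  obtain rfl | rfl := proc_cases l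
  · refine ⟨fun i y => P i (splitBits S (ext y)).1 0, fun i x => R i 0 (splitBits S (ext x)).2, ?_⟩
    intro y x hy hx
    rw [hU, hout y hy, hin x hx]
  · have h01 : ∀ p : Proc, p ≠ 0 ↔ p = 1 := by decide
    have h10 : ∀ p : Proc, p = 0 ↔ p ≠ 1 := by decide
    refine ⟨fun i y => R i (splitBits S (ext y)).2 0, fun i x => P i 0 (splitBits S (ext x)).1, ?_⟩
    intro y x hy hx
    rw [hU, hout x fun k hk => hx k ((h01 _).1 hk), hin y fun k hk => hy k ((h10 _).1 hk)]
    exact Finset.sum_congr rfl fun i _ => mul_comm _ _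

/-- The digits inserted for the two blocks are, together, the digits below `p`, each counted once.
Hence the product of the two rank bounds does not depend on the partition. -/
theorem le_four_mul_cost {n m p : ℕ} {π : Fin n → Proc} {T : Circuit m π}
    (h : T.Implements (QFT n)) (hp : ∀ l, p ≤ (Finset.univ.filter fun k => π k = l).card) :
    p ≤ 4 * Circuit.cost T := by
  have h01 : ∀ p : Proc, p ≠ 0 ↔ p = 1 := by decide
  have h10 : ∀ p : Proc, p ≠ 1 ↔ p = 0 := by decide
  have hpn : p ≤ n := (hp 0).trans ((Finset.card_filter_le _ _).trans (by simp))
  obtain ⟨ι, _, hr, f, g, hfg⟩ := h.exists_block_factor 0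
  obtain ⟨ι', _, hr', f', g', hfg'⟩ := h.exists_block_factor 1
  have b0 := two_pow_le_of_block_factor (p := p) π 0 f g hfg (by simpa only [h01] using hp 1)
  have b1 := two_pow_le_of_block_factor (p := p) π 1 f' g' hfg' (by simpa only [h10] using hp 0)
  set u := (Finset.univ.filter fun k : Fin n => (k : ℕ) < p ∧ π k ≠ 0).card with hu
  set v := (Finset.univ.filter fun k : Fin n => (k : ℕ) < p ∧ π k ≠ 1).card with hv
  have huv : u + v = p := by
    have e := Finset.card_filter_add_card_filter_not
      (s := Finset.univ.filter fun k : Fin n => (k : ℕ) < p) (fun k => π k ≠ 0)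
    rw [Finset.filter_filter, Finset.filter_filter] at e
    simp only [ne_eq, not_not] at e
    rw [hu, hv]
    simp only [h10]
    refine e.trans ?_
    rw [Fin.card_filter_val_lt]
    exact min_eq_right hpn
  have hmul : 2 ^ p * 2 ^ p ≤ 2 ^ (4 * Circuit.cost T) * 2 ^ p := by
    calc 2 ^ p * 2 ^ p ≤ (4 ^ Circuit.cost T * 2 ^ u) * (4 ^ Circuit.cost T * 2 ^ v) :=
          Nat.mul_le_mul (b0.trans (Nat.mul_le_mul_right _ hr))
            (b1.trans (Nat.mul_le_mul_right _ hr'))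
      _ = 2 ^ (4 * Circuit.cost T) * 2 ^ p := by
          rw [← huv, show (4 : ℕ) = 2 ^ 2 from rfl, ← pow_mul]; ring
  exact (Nat.pow_le_pow_iff_right (by norm_num)).1 (Nat.le_of_mul_le_mul_right hmul (by positivity))

/-! ### Controlled single-qubit gates -/

lemma agree_off_iff {Q : Type*} [DecidableEq Q] {q : Q} {y x : Bits Q} :
    (∀ r, r ≠ q → y r = x r) ↔ x = Function.update y q (x q) := by
  constructor
  · intro h
    funext r
    by_cases hr : r = q
    · subst hr; simp
    · simp [hr, h r hr]
  · intro h r hr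
    rw [h]; simp [hr]

section Mux

variable {Q : Type*} [Fintype Q] [DecidableEq Q]

/-- A single-qubit operator on the qubit `q` that is selected by the bits of the other qubits:
`g z` is the operator used when the other bits agree with `z`. It is only read at strings `z` with
`z q = 0`, so that it cannot depend on the bit it acts on. -/
def mux (q : Q) (g : Bits Q → Matrix (Fin 2) (Fin 2) ℂ) : Matrix (Bits Q) (Bits Q) ℂ :=
  fun y x => if ∀ r, r ≠ q → y r = x r then g (Function.update y q 0) (y q) (x q) else 0

lemma sum_agree_off (q : Q) (y : Bits Q) (F : Bits Q → ℂ) :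
    (∑ x, if ∀ r, r ≠ q → y r = x r then F x else 0) = ∑ s, F (Function.update y q s) := by
  rw [← Finset.sum_filter]
  symm
  refine Finset.sum_bij (fun s _ => Function.update y q s) ?_ ?_ ?_ ?_
  · intro s _
    simp only [Finset.mem_filter, Finset.mem_univ, true_and]
    intro r hr; simp [hr]
  · intro s _ s' _ h
    simpa using congrFun h q
  · intro x hx
    simp only [Finset.mem_filter, Finset.mem_univ, true_and] at hx
    exact ⟨x q, Finset.mem_univ _, (agree_off_iff.1 hx).symm⟩
  · intros; rfl

lemma mux_mulVec (q : Q) (g : Bits Q → Matrix (Fin 2) (Fin 2) ℂ) (v : Bits Q → ℂ) (y : Bits Q) :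
    (mux q g).mulVec v y = ∑ s, g (Function.update y q 0) (y q) s * v (Function.update y q s) := by
  have := sum_agree_off q y fun x => g (Function.update y q 0) (y q) (x q) * v x
  simpa [Matrix.mulVec, dotProduct, mux, ite_mul] using this

lemma mux_mul (q : Q) (g g' : Bits Q → Matrix (Fin 2) (Fin 2) ℂ) :
    mux q g * mux q g' = mux q fun z => g z * g' z := by
  ext y x
  have h := mux_mulVec q g (fun z => mux q g' z x) y
  have e : (mux q g * mux q g') y x = (mux q g).mulVec (fun z => mux q g' z x) y := rfl
  have hiff : ∀ s, (∀ r, r ≠ q → Function.update y q s r = x r) ↔ ∀ r, r ≠ q → y r = x r := by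
    intro s
    refine forall_congr' fun r => imp_congr_right fun hr => ?_
    rw [Function.update_of_ne hr]
  rw [e, h]
  simp only [mux, hiff, Function.update_idem, Function.update_self]
  split_ifs
  · rw [Matrix.mul_apply]
  · simp

lemma mux_one (q : Q) : mux q (fun _ => 1) = 1 := by
  ext y x
  rw [Matrix.one_apply, mux]
  by_cases h : y = x
  · subst h
    rw [if_pos fun _ _ => rfl, if_pos rfl, Matrix.one_apply_eq]
  · rw [if_neg h]
    split_ifs with h'
    · rw [Matrix.one_apply_ne]
      intro hq
      apply h
      funext r
      by_cases hr : r = q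
      · rw [hr, hq]
      · exact h' r hr
    · rfl

lemma mux_conjTranspose (q : Q) (g : Bits Q → Matrix (Fin 2) (Fin 2) ℂ) :
    (mux q g).conjTranspose = mux q fun z => (g z).conjTranspose := by
  ext y x
  rw [Matrix.conjTranspose_apply, mux, mux]
  by_cases h : ∀ r, r ≠ q → y r = x r
  · have h' : ∀ r, r ≠ q → x r = y r := fun r hr => (h r hr).symm
    have e : Function.update x q 0 = Function.update y q 0 := by
      rw [agree_off_iff.1 h]; simp
    rw [if_pos h, if_pos h', e, Matrix.conjTranspose_apply]
  · have h' : ¬ ∀ r, r ≠ q → x r = y r := fun h' => h fun r hr => (h' r hr).symm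
    rw [if_neg h, if_neg h', star_zero]

lemma mux_mem_unitaryGroup (q : Q) {g : Bits Q → Matrix (Fin 2) (Fin 2) ℂ}
    (hg : ∀ z, g z ∈ Matrix.unitaryGroup (Fin 2) ℂ) :
    mux q g ∈ Matrix.unitaryGroup (Bits Q) ℂ := by
  rw [Matrix.mem_unitaryGroup_iff, Matrix.star_eq_conjTranspose, mux_conjTranspose, mux_mul,
    ← mux_one q]
  congr 1
  funext z
  exact Matrix.mem_unitaryGroup_iff.1 (hg z)

lemma onQubits_mux (S : Finset Q) (q : S) (g : Bits S → Matrix (Fin 2) (Fin 2) ℂ) :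
    onQubits S (mux q g) = mux (q : Q) fun z => g fun r => z r := by
  ext y x
  have hiff : ((∀ r, r ∉ S → y r = x r) ∧ ∀ r : S, r ≠ q → y r = x r) ↔
      ∀ r, r ≠ (q : Q) → y r = x r := by
    constructor
    · rintro ⟨h1, h2⟩ r hr
      by_cases hS : r ∈ S
      · exact h2 ⟨r, hS⟩ fun h => hr (congrArg Subtype.val h)
      · exact h1 r hS
    · intro h
      exact ⟨fun r hr => h r fun e => hr (e ▸ q.2), fun r hr => h r fun e => hr (Subtype.ext e)⟩
  have hupd : (fun r : S => Function.update y (q : Q) 0 r) =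
      Function.update (fun r : S => y r) q 0 := by
    funext r
    by_cases hr : r = q
    · subst hr; simp
    · rw [Function.update_of_ne hr, Function.update_of_ne fun e => hr (Subtype.ext e)]
  rw [onQubits, mux, mux, hupd]
  simp only [← hiff, ite_and]

end Mux

/-! ### The gates of the Fourier circuit -/

/-- `e^{2πi r}`. -/
noncomputable def phase (r : ℝ) : ℂ := Complex.exp (2 * Real.pi * Complex.I * (r : ℂ))

lemma phase_add (r s : ℝ) : phase (r + s) = phase r * phase s := by
  rw [phase, phase, phase, ← Complex.exp_add]
  push_cast
  ring_nf

lemma phase_zero : phase 0 = 1 := by simp [phase]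

lemma phase_half : phase (1 / 2) = -1 := by
  rw [phase, ← Complex.exp_pi_mul_I]
  congr 1
  push_cast
  ring

lemma phase_mul_star (r : ℝ) : phase r * star (phase r) = 1 := by
  have : ‖phase r‖ = 1 := by
    rw [phase, show (2 * Real.pi * Complex.I * (r : ℂ)) = ((2 * Real.pi * r : ℝ) : ℂ) * Complex.I by
      push_cast; ring, Complex.norm_exp_ofReal_mul_I]
  rw [Complex.star_def, Complex.mul_conj, Complex.normSq_eq_norm_sq, this]
  simp

/-- A Hadamard gate followed by the phase shift by `r` turns. -/
noncomputable def hadamardPhase (r : ℝ) : Matrix (Fin 2) (Fin 2) ℂ :=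
  fun y x => (Real.sqrt 2 : ℂ)⁻¹ * if y = 1 then phase ((x : ℕ) / 2 + r) else 1

lemma hadamardPhase_mem (r : ℝ) : hadamardPhase r ∈ Matrix.unitaryGroup (Fin 2) ℂ := by
  have h2 : ((Real.sqrt 2 : ℂ)⁻¹) * (Real.sqrt 2 : ℂ)⁻¹ = 1 / 2 := by
    rw [← mul_inv, ← Complex.ofReal_mul, Real.mul_self_sqrt (by norm_num)]
    norm_num
  have hr := phase_mul_star r
  rw [Complex.star_def] at hr
  rw [Matrix.mem_unitaryGroup_iff]
  ext i j
  fin_cases i <;> fin_cases j <;>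
    simp [Matrix.mul_apply, Matrix.star_apply, hadamardPhase, Fin.sum_univ_two, phase_add,
      -one_div, phase_half, phase_zero]
  · linear_combination 2 * h2
  · linear_combination 2 * phase r * (starRingEnd ℂ) (phase r) * h2 + hr

/-- The phase shift by `r` turns. -/
noncomputable def phaseShift (r : ℝ) : Matrix (Fin 2) (Fin 2) ℂ :=
  Matrix.diagonal fun y => if y = 1 then phase r else 1

lemma phaseShift_mem (r : ℝ) : phaseShift r ∈ Matrix.unitaryGroup (Fin 2) ℂ := by
  have hr := phase_mul_star r
  rw [Matrix.mem_unitaryGroup_iff, phaseShift, Matrix.star_eq_conjTranspose,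
    Matrix.diagonal_conjTranspose, Matrix.diagonal_mul_diagonal, ← Matrix.diagonal_one]
  congr 1
  funext i
  simp only [Pi.star_apply]
  split_ifs
  · exact hr
  · simp

/-- The operator that adds the bit `c` modulo two. -/
def bitShift (c : Fin 2) : Matrix (Fin 2) (Fin 2) ℂ := fun y x => if x = y + c then 1 else 0

lemma bitShift_mem (c : Fin 2) : bitShift c ∈ Matrix.unitaryGroup (Fin 2) ℂ := by
  rw [Matrix.mem_unitaryGroup_iff]
  ext i j
  fin_cases c <;> fin_cases i <;> fin_cases j <;>
    simp [Matrix.mul_apply, Matrix.star_apply, bitShift]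

section Circuits

variable {n m : ℕ} {π : Fin n → Proc}

/-- The controlled single-qubit gate on `q`, with its controls on the processor `p` that holds
`q`. -/
def localMux (p : Proc) (q : Qubit n m) (hq : owner π q = p)
    (g : Bits (held m π p) → Matrix (Fin 2) (Fin 2) ℂ)
    (hg : ∀ z, g z ∈ Matrix.unitaryGroup (Fin 2) ℂ) : Gate m π :=
  .localOp p ⟨mux ⟨q, mem_held.2 hq⟩ g, mux_mem_unitaryGroup _ hg⟩

lemma localMux_mulVec (p : Proc) (q : Qubit n m) (hq : owner π q = p)
    (g : Bits (held m π p) → Matrix (Fin 2) (Fin 2) ℂ)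
    (hg : ∀ z, g z ∈ Matrix.unitaryGroup (Fin 2) ℂ) (v : Bits (Qubit n m) → ℂ)
    (y : Bits (Qubit n m)) :
    (localMux p q hq g hg).op.mulVec v y = ∑ s, g (fun r => Function.update y q 0 r) (y q) s *
      v (Function.update y q s) := by
  rw [localMux, Gate.op, onQubits_mux, mux_mulVec]

/-- The CNOT gate with control `a` and target `b` on different processors. -/
def cnot (a b : Qubit n m) (hab : owner π a ≠ owner π b) : Gate m π :=
  .nonlocal a b hab ⟨mux ⟨b, by simp⟩ fun z => bitShift (z ⟨a, by simp⟩),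
    mux_mem_unitaryGroup _ fun _ => bitShift_mem _⟩

lemma cnot_mulVec (a b : Qubit n m) (hab : owner π a ≠ owner π b) (v : Bits (Qubit n m) → ℂ)
    (y : Bits (Qubit n m)) :
    (cnot a b hab).op.mulVec v y = v (Function.update y b (y b + y a)) := by
  have hne : a ≠ b := fun h => hab (congrArg _ h)
  rw [cnot, Gate.op, onQubits_mux, mux_mulVec]
  simp [bitShift, hne]

end Circuits

/-! ### The Fourier circuit -/

section FourierCircuit

variable {n : ℕ}

/-- The part of the binary fraction `0.x_t x_{t+1} ⋯` after its first digit that comes from the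
digits held by `p`. -/
noncomputable def tailFrac (π : Fin n → Proc) (p : Proc) (t : Fin n) (x : Bits (Fin n)) : ℝ :=
  ∑ k ∈ Finset.Ioi t, if π k = p then ((x k : ℕ) : ℝ) / 2 ^ ((k : ℕ) - (t : ℕ) + 1) else 0

lemma binFrac_eq (π : Fin n → Proc) {p p' : Proc} (hp : p ≠ p') (t : Fin n) (x : Bits (Fin n)) :
    binFrac x t = ((x t : ℕ) : ℝ) / 2 + tailFrac π p t x + tailFrac π p' t x := by
  have h : ∀ l : Proc, l = p ↔ ¬ l = p' := by revert p p'; decide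
  rw [binFrac, ← Finset.Ioi_insert, Finset.sum_insert (by simp), add_assoc, tailFrac, tailFrac,
    ← Finset.sum_add_distrib]
  congr 1
  · simp
  · refine Finset.sum_congr rfl fun k _ => ?_
    by_cases hk : π k = p' <;> simp [h, hk]

lemma tailFrac_congr (π : Fin n → Proc) (p : Proc) {t : Fin n} {x x' : Bits (Fin n)}
    (h : ∀ k, t < k → x k = x' k) : tailFrac π p t x = tailFrac π p t x' :=
  Finset.sum_congr rfl fun k hk => by rw [h k (Finset.mem_Ioi.1 hk)]

lemma binFrac_congr {t : Fin n} {x x' : Bits (Fin n)} (h : ∀ k, t ≤ k → x k = x' k) :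
    binFrac x t = binFrac x' t :=
  Finset.sum_congr rfl fun k hk => by rw [h k (Finset.mem_Ici.1 hk)]

/-- One round of the Fourier circuit: the Hadamard gate on the qubit `t` and the phase shifts of
`t` controlled by later qubits on the same processor. -/
noncomputable def localRound (π : Fin n → Proc) (t : Fin n) : Matrix (Bits (Fin n)) (Bits (Fin n)) ℂ :=
  mux t fun z => hadamardPhase (tailFrac π (π t) t z)

/-- The phase shifts of the qubit `t` controlled by later qubits held by `p`. -/
noncomputable def crossRound (π : Fin n → Proc) (p : Proc) (t : Fin n) :
    Matrix (Bits (Fin n)) (Bits (Fin n)) ℂ :=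
  mux t fun z => phaseShift (tailFrac π p t z)

/-- The Fourier transform after the rounds `j < t`. -/
noncomputable def partialQFT (n t : ℕ) : Matrix (Bits (Fin n)) (Bits (Fin n)) ℂ :=
  fun y x => if ∀ k : Fin n, t ≤ k → y k = x k then
    ((Real.sqrt 2 : ℂ) ^ t)⁻¹ * ∏ j ∈ Finset.univ.filter (fun j : Fin n => (j : ℕ) < t),
      if y j = 1 then phase (binFrac x j) else 1 else 0

lemma partialQFT_zero : partialQFT n 0 = 1 := by
  ext y x
  simp [partialQFT, Matrix.one_apply, funext_iff]

lemma partialQFT_self : partialQFT n n = QFT n := by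
  ext y x
  have h : ∀ k : Fin n, n ≤ k → y k = x k := fun k hk => absurd k.2 hk.not_gt
  rw [partialQFT, if_pos h, QFT]
  simp [phase]

lemma crossRound_mul_localRound (π : Fin n → Proc) (p : Proc) (t : Fin n) :
    crossRound π p t * localRound π t = mux t fun z =>
      hadamardPhase (tailFrac π (π t) t z + tailFrac π p t z) := by
  rw [crossRound, localRound, mux_mul]
  congr 1
  funext z
  ext i j
  rw [phaseShift, Matrix.diagonal_mul]
  simp only [hadamardPhase]
  split_ifs
  · simp only [phase_add]; ring
  · ring

lemma partialQFT_succ (π : Fin n → Proc) {p : Proc} {t : Fin n} (hp : π t ≠ p) :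
    partialQFT n (t + 1) = crossRound π p t * (localRound π t * partialQFT n t) := by
  rw [← Matrix.mul_assoc, crossRound_mul_localRound π p]
  ext y x
  have e := mux_mulVec t (fun z => hadamardPhase (tailFrac π (π t) t z + tailFrac π p t z))
    (fun z => partialQFT n t z x) y
  refine Eq.trans ?_ e.symm
  have hne : ∀ k : Fin n, (t : ℕ) + 1 ≤ k → k ≠ t := by
    rintro k hk rfl; omega
  by_cases h : ∀ k : Fin n, (t : ℕ) + 1 ≤ k → y k = x k
  · -- only the term in which the qubit `t` still has its input value survives
    have hx : ∀ k : Fin n, (t : ℕ) ≤ k → Function.update y t (x t) k = x k := by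
      intro k hk
      by_cases hkt : k = t
      · subst hkt; simp
      · rw [Function.update_of_ne hkt]
        exact h k (by have := Fin.val_ne_of_ne hkt; omega)
    rw [Finset.sum_eq_single (x t)]
    · have htail : ∀ l, tailFrac π l t (Function.update y t 0) = tailFrac π l t x := fun l =>
        tailFrac_congr π l fun k hk => by
          rw [Function.update_of_ne hk.ne']; exact h k hk
      have hset : (Finset.univ.filter fun j : Fin n => (j : ℕ) < t + 1) =
          insert t (Finset.univ.filter fun j : Fin n => (j : ℕ) < t) := by
        ext j
        simp only [Finset.mem_filter, Finset.mem_univ, true_and, Finset.mem_insert, Fin.ext_iff]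
        omega
      have hprod : (∏ j ∈ Finset.univ.filter (fun j : Fin n => (j : ℕ) < t),
          if Function.update y t (x t) j = 1 then phase (binFrac x j) else 1) =
          ∏ j ∈ Finset.univ.filter (fun j : Fin n => (j : ℕ) < t),
          if y j = 1 then phase (binFrac x j) else 1 := by
        refine Finset.prod_congr rfl fun j hj => ?_
        rw [Function.update_of_ne]
        rintro rfl
        simp at hj
      rw [partialQFT, partialQFT, if_pos h, if_pos hx, hset, Finset.prod_insert (by simp), hprod,
        htail, htail, hadamardPhase, binFrac_eq π hp t x, add_assoc, pow_succ, mul_inv]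
      ring
    · intro s _ hs
      rw [partialQFT, if_neg, mul_zero]
      intro h'
      exact hs (by simpa using h' t le_rfl)
    · simp
  · rw [partialQFT, if_neg h, Finset.sum_eq_zero]
    intro s _
    rw [partialQFT, if_neg, mul_zero]
    intro h'
    refine h fun k hk => ?_
    have := h' k (by omega)
    rwa [Function.update_of_ne (hne k hk)] at this

variable {m : ℕ} {π : Fin n → Proc}

lemma Circuit.Implements.append {T T' : Circuit m π} {U U' : Matrix (Bits (Fin n)) (Bits (Fin n)) ℂ}
    (h : T.Implements U) (h' : T'.Implements U') : Circuit.Implements (T ++ T') (U * U') := by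
  intro ψ
  have : Circuit.op (T ++ T') = Circuit.op T * Circuit.op T' := by simp [Circuit.op]
  rw [this, ← Matrix.mulVec_mulVec, h' ψ, h, Matrix.mulVec_mulVec]

lemma Circuit.implements_nil : Circuit.Implements ([] : Circuit m π) 1 := by
  intro ψ
  simp [Circuit.op]

lemma Circuit.cost_append (T T' : Circuit m π) :
    Circuit.cost (T ++ T') = Circuit.cost T + Circuit.cost T' := by
  simp [Circuit.cost]

lemma update_inl_comp (y : Bits (Qubit n m)) (t : Fin n) (s : Fin 2) :
    (fun i => Function.update y (Sum.inl t) s (Sum.inl i)) =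
      Function.update (fun i => y (Sum.inl i)) t s := by
  funext i
  by_cases h : i = t
  · subst h; simp
  · simp [h]

/-- `tailFrac`, read off the register of the processor `p` only. -/
noncomputable def heldTailFrac (m : ℕ) (π : Fin n → Proc) (p : Proc) (t : Fin n)
    (z : Bits (held m π p)) : ℝ :=
  ∑ k ∈ Finset.Ioi t, if h : π k = p then
    ((z ⟨Sum.inl k, mem_held.2 h⟩ : ℕ) : ℝ) / 2 ^ ((k : ℕ) - (t : ℕ) + 1) else 0

lemma heldTailFrac_restrict (p : Proc) (t : Fin n) (z : Bits (Qubit n m)) :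
    heldTailFrac m π p t (fun r => z r) = tailFrac π p t fun i => z (Sum.inl i) := by
  simp [heldTailFrac, tailFrac]

lemma exists_implements_localRound (t : Fin n) :
    ∃ T : Circuit m π, T.Implements (localRound π t) ∧ Circuit.cost T = 0 := by
  have ht : owner π (Sum.inl t : Qubit n m) = π t := rfl
  refine ⟨[localMux (π t) (Sum.inl t) ht (fun z => hadamardPhase (heldTailFrac m π (π t) t z))
    fun _ => hadamardPhase_mem _], fun ψ => ?_, by simp [Circuit.cost, localMux, Gate.cost]⟩
  funext y
  simp only [Circuit.op, List.map_cons, List.map_nil, List.prod_cons, List.prod_nil, mul_one]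
  rw [localMux_mulVec, withAncillas, localRound, mux_mulVec]
  simp only [withAncillas, update_inl_comp, heldTailFrac_restrict, ne_eq, reduceCtorEq,
    not_false_eq_true, Function.update_of_ne]
  split_ifs
  · rfl
  · simp

/-- The bit of `t` is copied to an ancilla on the processor `p`, which applies its phase shifts
to that ancilla before the copy is undone. -/
lemma exists_implements_crossRound (hm : 1 ≤ m) {p : Proc} {t : Fin n} (hp : π t ≠ p) :
    ∃ T : Circuit m π, T.Implements (crossRound π p t) ∧ Circuit.cost T = 2 := by
  let a : Qubit n m := Sum.inl t
  let b : Qubit n m := Sum.inr (p, ⟨0, hm⟩)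
  have hab : owner π a ≠ owner π b := hp
  have hb : owner π b = p := rfl
  refine ⟨[cnot a b hab, localMux p b hb (fun z => phaseShift (heldTailFrac m π p t z))
    fun _ => phaseShift_mem _, cnot a b hab], fun ψ => ?_,
    by simp [Circuit.cost, localMux, cnot, Gate.cost]⟩
  funext y
  simp only [Circuit.op, List.map_cons, List.map_nil, List.prod_cons, List.prod_nil, mul_one]
  rw [← Matrix.mulVec_mulVec, ← Matrix.mulVec_mulVec, cnot_mulVec, localMux_mulVec]
  have hba : a ≠ b := by simp [a, b]
  have hdata : ∀ s, (fun i => Function.update y b s (Sum.inl i)) = fun i => y (Sum.inl i) := by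
    intro s; funext i; simp [b]
  have hadd : ∀ u w : Fin 2, u + w + w = u := by decide
  simp only [cnot_mulVec, Function.update_idem, Function.update_self, ne_eq, hba,
    not_false_eq_true, Function.update_of_ne]
  rw [Finset.sum_eq_single (y b + y a) (fun s _ hs => by
    rw [phaseShift, Matrix.diagonal_apply_ne _ (Ne.symm hs), zero_mul]) (by simp), hadd,
    Function.update_eq_self, phaseShift, Matrix.diagonal_apply_eq]
  have htail : heldTailFrac m π p t (fun r => Function.update y b 0 r) =
      tailFrac π p t fun i => y (Sum.inl i) := by
    rw [heldTailFrac_restrict, hdata]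
  have hD : (crossRound π p t).mulVec ψ (fun i => y (Sum.inl i)) =
      (if y a = 1 then phase (tailFrac π p t fun i => y (Sum.inl i)) else 1) *
        ψ fun i => y (Sum.inl i) := by
    rw [crossRound, mux_mulVec, Finset.sum_eq_single (y a) (fun s _ hs => by
      rw [phaseShift, Matrix.diagonal_apply_ne _ (Ne.symm hs), zero_mul]) (by simp), phaseShift,
      Matrix.diagonal_apply_eq, tailFrac_congr π p (x' := fun i => y (Sum.inl i))
        fun k hk => Function.update_of_ne hk.ne' _ _]
    congr 2
    exact Function.update_eq_self _ _
  rw [htail, withAncillas, withAncillas, hD]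
  split_ifs with h0 h1 h2 h2
  all_goals first | rfl | simp_all [b]

end FourierCircuit

/-! ### Balanced partitions and the two bounds -/

/-- The first `n / 2` qubits on the first processor, the others on the second one. -/
def halves (n : ℕ) (k : Fin n) : Proc := if (k : ℕ) < n / 2 then 0 else 1

lemma card_halves (n : ℕ) :
    (Finset.univ.filter fun k => halves n k = 0).card = n / 2 ∧
      (Finset.univ.filter fun k => halves n k = 1).card = n - n / 2 := by
  have h0 : (Finset.univ.filter fun k => halves n k = 0).card = n / 2 := by
    have : ∀ k : Fin n, halves n k = 0 ↔ (k : ℕ) < n / 2 := fun k => by simp [halves]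
    simp only [this, Fin.card_filter_val_lt]
    omega
  have h1 : ∀ p : Proc, ¬ p = 0 ↔ p = 1 := by decide
  have e := Finset.card_filter_add_card_filter_not (s := Finset.univ) fun k => halves n k = 0
  simp only [h1, Finset.card_univ, Fintype.card_fin] at e
  exact ⟨h0, by omega⟩

lemma balanced_halves {c : ℝ} (hc : 1 / 2 ≤ c) (n : ℕ) : Balanced c (halves n) := by
  intro p
  obtain ⟨h0, h1⟩ := card_halves n
  have e1 : ((n / 2 : ℕ) : ℝ) ≤ n / 2 := Nat.cast_div_le
  have e2 : (n : ℝ) ≤ 2 * ((n / 2 : ℕ) : ℝ) + 1 := by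
    exact_mod_cast (by omega : n ≤ 2 * (n / 2) + 1)
  obtain rfl | rfl := proc_cases p
  · rw [h0, abs_le]
    constructor <;> linarith
  · rw [h1, Nat.cast_sub (Nat.div_le_self n 2), abs_le]
    constructor <;> linarith

/-- With the qubits split into halves, only rounds on the first half need communication. -/
lemma exists_implements_partialQFT {n m : ℕ} (hm : 1 ≤ m) (t : ℕ) (ht : t ≤ n) :
    ∃ T : Circuit m (halves n), T.Implements (partialQFT n t) ∧
      Circuit.cost T = 2 * min t (n / 2) := by
  induction t with
  | zero => exact ⟨[], by rw [partialQFT_zero]; exact Circuit.implements_nil, by simp [Circuit.cost]⟩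
  | succ t ih =>
    obtain ⟨T, hT, hcost⟩ := ih (by omega)
    let s : Fin n := ⟨t, ht⟩
    obtain ⟨L, hL, hLc⟩ := exists_implements_localRound (m := m) (π := halves n) s
    by_cases hs : t < n / 2
    · have hp : halves n s ≠ 1 := by simp [halves, s, hs]
      obtain ⟨X, hX, hXc⟩ := exists_implements_crossRound hm hp
      refine ⟨X ++ (L ++ T), ?_, ?_⟩
      · rw [show t + 1 = (s : ℕ) + 1 from rfl, partialQFT_succ (halves n) hp]
        exact hX.append (hL.append hT)
      · rw [Circuit.cost_append, Circuit.cost_append, hXc, hLc, hcost]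
        omega
    · -- all later qubits are on the same processor
      have hp : halves n s ≠ 0 := by simp [halves, s, hs]
      have hX : crossRound (halves n) 0 s = 1 := by
        have h0 : ∀ z, tailFrac (halves n) 0 s z = 0 := fun z =>
          Finset.sum_eq_zero fun k hk => if_neg (by
            have hs' : s < k := Finset.mem_Ioi.1 hk
            have hk' : t < (k : ℕ) := hs'
            simp only [halves]
            rw [if_neg (by omega)]
            decide)
        rw [crossRound, ← mux_one s]
        congr 1
        funext z
        simp [h0, phaseShift, phase_zero]
      refine ⟨L ++ T, ?_, ?_⟩
      · rw [show t + 1 = (s : ℕ) + 1 from rfl, partialQFT_succ (halves n) hp, hX, one_mul]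
        exact hL.append hT
      · rw [Circuit.cost_append, hLc, hcost]
        omega

theorem commCost_QFT_le {c : ℝ} (hc : 1 / 2 ≤ c) {m : ℕ} (hm : 1 ≤ m) (n : ℕ) :
    commCost c m (QFT n) ≤ (n : ℕ∞) := by
  obtain ⟨T, hT, hcost⟩ := exists_implements_partialQFT (n := n) hm n le_rfl
  rw [partialQFT_self] at hT
  refine (iInf₂_le (halves n) (balanced_halves hc n)).trans ((iInf₂_le T hT).trans ?_)
  rw [hcost]
  exact_mod_cast (by omega : 2 * min n (n / 2) ≤ n)

lemma le_cost_of_balanced {c : ℝ} {n m : ℕ} (hn : 4 * c ≤ n) {π : Fin n → Proc} (hπ : Balanced c π)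
    {T : Circuit m π} (hT : T.Implements (QFT n)) : (1 / 16 : ℝ) * n ≤ Circuit.cost T := by
  set p := min (Finset.univ.filter fun k => π k = 0).card
    (Finset.univ.filter fun k => π k = 1).card with hp
  have h := le_four_mul_cost (p := p) hT fun l => by
    obtain rfl | rfl := proc_cases l
    · exact min_le_left _ _
    · exact min_le_right _ _
  have hp' : (n : ℝ) / 2 - c ≤ p := by
    rw [hp, Nat.cast_min]
    exact le_min (by linarith [(abs_le.1 (hπ 0)).1]) (by linarith [(abs_le.1 (hπ 1)).1])
  have h' : (p : ℝ) ≤ 4 * (Circuit.cost T : ℝ) := by exact_mod_cast h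
  linarith

theorem le_commCost_QFT {c : ℝ} {n : ℕ} (hn : 4 * c ≤ n) (m : ℕ) :
    ((⌈(1 / 16 : ℝ) * n⌉₊ : ℕ) : ℕ∞) ≤ commCost c m (QFT n) :=
  le_iInf₂ fun _ hπ => le_iInf₂ fun _ hT =>
    Nat.cast_le.2 (Nat.ceil_le.2 (le_cost_of_balanced hn hπ hT))

lemma ofReal_le_of_ceil_le {r : ℝ} {k : ℕ∞} (h : ((⌈r⌉₊ : ℕ) : ℕ∞) ≤ k) :
    ENNReal.ofReal r ≤ (k : ℝ≥0∞) := by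
  have h1 : (((⌈r⌉₊ : ℕ) : ℕ∞) : ℝ≥0∞) ≤ k := by exact_mod_cast h
  refine le_trans ?_ h1
  rw [ENat.toENNReal_coe]
  exact ENNReal.ofReal_le_of_le_toReal (by simpa using Nat.le_ceil r)

end QComm

theorem mainTheorem3 (c : ℝ) (hc : 1 / 2 ≤ c) :
    (∀ m : ℕ, 1 ≤ m → ∃ a b : ℝ, 0 < a ∧ 0 < b ∧ ∃ N : ℕ, ∀ n : ℕ, N ≤ n →
      ENNReal.ofReal (a * n) ≤ (QComm.commCost c m (QComm.QFT n) : ℝ≥0∞) ∧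
      (QComm.commCost c m (QComm.QFT n) : ℝ≥0∞) ≤ ENNReal.ofReal (b * n)) ∧
    (∀ n : ℕ, QComm.commCost c 1 (QComm.QFT n) ≤ (n : ℕ∞)) ∧
    (∃ a : ℝ, 0 < a ∧ ∃ N : ℕ, ∀ n : ℕ, N ≤ n →
      ENNReal.ofReal (a * n) ≤ (QComm.commInf c (QComm.QFT n) : ℝ≥0∞)) := by
  have hN : ∀ n : ℕ, ⌈4 * c⌉₊ ≤ n → 4 * c ≤ n := fun n hn => Nat.ceil_le.1 hn
  refine ⟨fun m hm => ⟨1 / 16, 1, by norm_num, by norm_num, ⌈4 * c⌉₊, fun n hn => ⟨?_, ?_⟩⟩,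
    fun n => QComm.commCost_QFT_le hc le_rfl n,
    ⟨1 / 16, by norm_num, ⌈4 * c⌉₊, fun n hn => ?_⟩⟩
  · exact QComm.ofReal_le_of_ceil_le (QComm.le_commCost_QFT (hN n hn) m)
  · rw [one_mul, ENNReal.ofReal_natCast]
    exact_mod_cast ENat.toENNReal_le.2 (QComm.commCost_QFT_le hc hm n)
  · exact QComm.ofReal_le_of_ceil_le (le_iInf fun m => QComm.le_commCost_QFT (hN n hn) m)
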